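/- Let $p$ be a prime number and let $Y$ be a path-connected topological space with base point $y_0$ whose fundamental group $\pi_1 Y = \pi_1(Y, y_0)$ is a finite $p$-group. Let $M$ be a finite $\mathbb{F}_p[\pi_1 Y]$-module. Let $H^*(Y;\mathbb{F}_p) = \bigoplus_{n\ge 0} H^n(Y;\mathbb{F}_p)$ be the singular cohomology of $Y$, a graded $\mathbb{F}_p$-algebra under the cup product, and let $H^*(Y;M) = \bigoplus_{n\ge 0} H^n(Y;M)$ be the singular cohomology of $Y$ with (twisted) coefficients in $M$, a graded $H^*(Y;\mathbb{F}_p)$-module under the cup product. If the graded $\mathbb{F}_p$-algebra $H^*(Y;\mathbb{F}_p)$ is Noetherian, then $H^*(Y;M)$ is Noetherian as a module over $H^*(Y;\mathbb{F}_p)$. -/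

import Mathlib

open scoped DirectSum

universe u v w

namespace TwistedCoh

/-! ### Standard simplices and families of simplices -/

/-- The standard topological `n`-simplex. -/
abbrev Simplex (n : ℕ) : Type := stdSimplex ℝ (Fin (n + 1))

/-- The affine map of standard simplices given by a map of vertices. -/
noncomputable def simplexMap {m n : ℕ} (φ : Fin (m + 1) → Fin (n + 1)) :
    C(Simplex m, Simplex n) :=
  ⟨stdSimplex.map φ, stdSimplex.continuous_map φ⟩

theorem simplexMap_comp {l m n : ℕ} (φ : Fin (m + 1) → Fin (n + 1))
    (ψ : Fin (l + 1) → Fin (m + 1)) :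
    (simplexMap φ).comp (simplexMap ψ) = simplexMap (φ ∘ ψ) := by
  ext1 x
  exact stdSimplex.map_comp_apply ψ φ x

theorem simplexMap_id {n : ℕ} : simplexMap (id : Fin (n + 1) → Fin (n + 1)) = .id _ := by
  ext1 x
  exact stdSimplex.map_id_apply x

/-- Sets `S n` of "`n`-simplices" that can be reparametrized along continuous maps between
standard simplices (in particular along face maps). -/
class SimplexFamily (S : ℕ → Type u) where
  /-- Reparametrization of an `n`-simplex along a map `Δᵐ → Δⁿ`. -/
  pull : ∀ {m n : ℕ}, C(Simplex m, Simplex n) → S n → S m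
  pull_id : ∀ {n : ℕ} (x : S n), pull (.id _) x = x
  pull_comp : ∀ {l m n : ℕ} (f : C(Simplex m, Simplex n)) (g : C(Simplex l, Simplex m)) (x : S n),
    pull (f.comp g) x = pull g (pull f x)

open SimplexFamily

/-- The simplex of `S` obtained from `x` by a map of vertices. -/
noncomputable def restr {S : ℕ → Type u} [SimplexFamily S] {m n : ℕ}
    (φ : Fin (m + 1) → Fin (n + 1)) (x : S n) : S m :=
  pull (simplexMap φ) x

theorem restr_restr {S : ℕ → Type u} [SimplexFamily S] {l m n : ℕ}
    (φ : Fin (m + 1) → Fin (n + 1)) (ψ : Fin (l + 1) → Fin (m + 1)) (x : S n) :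
    restr ψ (restr φ x) = restr (φ ∘ ψ) x := by
  rw [restr, restr, restr, ← pull_comp, simplexMap_comp]

theorem restr_id {S : ℕ → Type u} [SimplexFamily S] {n : ℕ} (x : S n) :
    restr (id : Fin (n + 1) → Fin (n + 1)) x = x := by
  rw [restr, simplexMap_id, pull_id]

/-- The map of vertices `[l] → [n]`, `k ↦ a + k`, whose image is `{a, …, a + l}`. -/
def interval {n : ℕ} (a l : ℕ) (h : a + l ≤ n) (k : Fin (l + 1)) : Fin (n + 1) :=
  ⟨a + k, by omega⟩

/-- The map of vertices `[n] → [n + 1]` that omits the value `k` (if `k ≤ n + 1`). -/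
def skip (n k : ℕ) (m : Fin (n + 1)) : Fin (n + 2) :=
  ⟨if (m : ℕ) < k then m else m + 1, by split_ifs <;> omega⟩

theorem skip_eq (n : ℕ) (i : Fin (n + 2)) : i.succAbove = skip n i := by
  funext m
  ext
  simp only [skip, Fin.succAbove, Fin.lt_def, Fin.val_castSucc]
  split_ifs <;> simp

/-! ### Cochains, coboundary and cup product -/

section Cochains

variable (R : Type v) [CommRing R] {S : ℕ → Type u} [SimplexFamily S]
  {A : Type w} [AddCommGroup A] [Module R A]

/-- The coboundary `(δ f)(x) = ∑ᵢ (-1)ⁱ f(dᵢ x)` on `A`-valued cochains; `dᵢ x` is the face of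
`x` opposite to the `i`-th vertex. -/
noncomputable def coboundary (n : ℕ) : (S n → A) →ₗ[R] (S (n + 1) → A) where
  toFun f x := ∑ i : Fin (n + 2), (-1 : ℤ) ^ (i : ℕ) • f (restr i.succAbove x)
  map_add' f g := by
    ext x
    simp [Finset.sum_add_distrib]
  map_smul' r f := by
    ext x
    simp [Finset.smul_sum, smul_comm r]

theorem coboundary_apply (n : ℕ) (f : S n → A) (x : S (n + 1)) :
    coboundary R n f x = ∑ i : Fin (n + 2), (-1 : ℤ) ^ (i : ℕ) • f (restr i.succAbove x) := rfl

variable {R} in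
/-- The Alexander–Whitney cup product `(a ∪ f)(x) = a(front i-face of x) • f(back j-face of x)`. -/
noncomputable def cup {i j : ℕ} (a : S i → R) (f : S j → A) : S (i + j) → A := fun x =>
  a (restr (interval 0 i (by omega)) x) • f (restr (interval i j le_rfl) x)

end Cochains

section CochainFacts

variable {R : Type v} [CommRing R] {S : ℕ → Type u} [SimplexFamily S]
  {A : Type w} [AddCommGroup A] [Module R A]

theorem coboundary_apply_range (n : ℕ) (f : S n → A) (x : S (n + 1)) :
    coboundary R n f x = ∑ k ∈ Finset.range (n + 2), (-1 : ℤ) ^ k • f (restr (skip n k) x) := by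
  rw [coboundary_apply,
    ← Fin.sum_univ_eq_sum_range (fun k => (-1 : ℤ) ^ k • f (restr (skip n k) x)) (n + 2)]
  refine Finset.sum_congr rfl fun i _ => ?_
  rw [skip_eq]

theorem coboundary_coboundary (n : ℕ) (f : S n → A) :
    coboundary R (n + 1) (coboundary R n f) = 0 := by
  ext x
  simp only [coboundary_apply, Pi.zero_apply, Finset.smul_sum, restr_restr, smul_smul, ← pow_add]
  rw [← Finset.sum_product']
  refine Finset.sum_involution (fun q _ => (q.1.succAbove q.2, q.2.predAbove q.1)) ?_ ?_ ?_ ?_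
  · rintro ⟨a, b⟩ -
    have h1 : (a.succAbove b).succAbove ∘ (b.predAbove a).succAbove
        = a.succAbove ∘ b.succAbove := by
      funext k
      simp [Fin.succAbove_succAbove_succAbove_predAbove]
    have h2 := Fin.neg_one_pow_succAbove_add_predAbove (R := ℤ) a b
    simp only [h1, h2, neg_smul, add_neg_cancel]
  · rintro ⟨a, b⟩ - - h
    exact Fin.succAbove_ne a b (congrArg Prod.fst h)
  · simp
  · rintro ⟨a, b⟩ -
    ext1
    · simp [Fin.succAbove_succAbove_predAbove]
    · exact Fin.predAbove_predAbove_succAbove a b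

/-- The Leibniz rule. -/
theorem coboundary_cup {i j : ℕ} (a : S i → R) (f : S j → A) (x : S (i + j + 1)) :
    coboundary R (i + j) (cup a f) x =
      coboundary R i a (restr (interval 0 (i + 1) (by omega)) x) •
        f (restr (interval (i + 1) j (by omega)) x) +
      (-1 : ℤ) ^ i • a (restr (interval 0 i (by omega)) x) •
        coboundary R j f (restr (interval i (j + 1) (by omega)) x) := by
  simp only [coboundary_apply_range, cup, restr_restr]
  have hr : Finset.range (i + j + 2) = Finset.range ((i + 1) + (j + 1)) := by
    congr 1
    omega
  rw [hr, Finset.sum_range_add,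
    Finset.sum_range_succ _ (i + 1), Finset.sum_range_succ' _ (j + 1)]
  have e1 : ∀ k ∈ Finset.range (i + 1),
      (-1 : ℤ) ^ k • a (restr (skip (i + j) k ∘ interval 0 i (by omega)) x) •
        f (restr (skip (i + j) k ∘ interval i j le_rfl) x) =
      ((-1 : ℤ) ^ k • a (restr (interval 0 (i + 1) (by omega) ∘ skip i k) x)) •
        f (restr (interval (i + 1) j (by omega)) x) := by
    intro k hk
    have hk := Finset.mem_range.1 hk
    have h1 : skip (i + j) k ∘ interval 0 i (by omega)
        = interval (n := i + j + 1) 0 (i + 1) (by omega) ∘ skip i k := by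
      funext m; ext; simp only [Function.comp, skip, interval]; grind
    have h2 : skip (i + j) k ∘ interval i j le_rfl
        = interval (n := i + j + 1) (i + 1) j (by omega) := by
      funext m; ext; simp only [Function.comp, skip, interval]; grind
    rw [h1, h2, smul_assoc]
  have e2 : ∀ k ∈ Finset.range (j + 1),
      (-1 : ℤ) ^ (i + 1 + k) • a (restr (skip (i + j) (i + 1 + k) ∘ interval 0 i (by omega)) x) •
        f (restr (skip (i + j) (i + 1 + k) ∘ interval i j le_rfl) x) =
      (-1 : ℤ) ^ i • a (restr (interval 0 i (by omega)) x) •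
        (-1 : ℤ) ^ (k + 1) • f (restr (interval i (j + 1) (by omega) ∘ skip j (k + 1)) x) := by
    intro k hk
    have hk := Finset.mem_range.1 hk
    have h1 : skip (i + j) (i + 1 + k) ∘ interval 0 i (by omega)
        = interval (n := i + j + 1) 0 i (by omega) := by
      funext m; ext; simp only [Function.comp, skip, interval]; grind
    have h2 : skip (i + j) (i + 1 + k) ∘ interval i j le_rfl
        = interval (n := i + j + 1) i (j + 1) (by omega) ∘ skip j (k + 1) := by
      funext m; ext; simp only [Function.comp, skip, interval]; grind
    rw [h1, h2, smul_comm _ ((-1 : ℤ) ^ (k + 1)), smul_smul ((-1 : ℤ) ^ i), ← pow_add]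
    congr 2
    omega
  rw [Finset.sum_congr rfl e1, Finset.sum_congr rfl e2]
  have h1 : interval (n := i + j + 1) 0 (i + 1) (by omega) ∘ skip i (i + 1)
      = interval 0 i (by omega) := by
    funext m; ext; simp only [Function.comp, skip, interval]; grind
  have h2 : interval (n := i + j + 1) i (j + 1) (by omega) ∘ skip j 0
      = interval (i + 1) j (by omega) := by
    funext m; ext; simp only [Function.comp, skip, interval]; grind
  rw [h1, h2, add_smul, smul_add, smul_add, Finset.sum_smul, Finset.smul_sum, Finset.smul_sum]
  simp only [pow_succ, pow_zero, smul_assoc, mul_neg, mul_one, neg_smul, one_smul]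
  abel

theorem cup_assoc {i j k : ℕ} (a : S i → R) (b : S j → R) (f : S k → A) (x : S (i + j + k)) :
    cup (cup a b) f x = cup a (cup b f) (restr (Fin.cast (by omega)) x) := by
  simp only [cup, restr_restr, smul_assoc]
  have h : i + (j + k) + 1 = i + j + k + 1 := by omega
  have e1 : Fin.cast h ∘ interval 0 i (by omega)
      = interval 0 (i + j) (by omega) ∘ interval 0 i (by omega) := by
    funext m; ext; simp [interval]
  have e2 : Fin.cast h ∘ interval i (j + k) le_rfl ∘ interval 0 j (by omega)
      = interval 0 (i + j) (by omega) ∘ interval i j le_rfl := by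
    funext m; ext; simp [interval]
  have e3 : Fin.cast h ∘ interval i (j + k) le_rfl ∘ interval j k le_rfl
      = interval (i + j) k le_rfl := by
    funext m; ext; simp [interval]; omega
  simp only [Function.comp_assoc, e1, e2, e3]

end CochainFacts

/-! ### Cohomology of a complex of cochains -/

section Cohomology

variable {R : Type v} [CommRing R] {S : ℕ → Type u} [SimplexFamily S]
  {A : Type w} [AddCommGroup A] [Module R A]

/-- The cocycles among the cochains in `D`. -/
noncomputable def cocycles (D : ∀ n, Submodule R (S n → A)) (n : ℕ) : Submodule R (S n → A) :=
  D n ⊓ LinearMap.ker (coboundary R n)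

/-- The coboundaries of the cochains in `D`. -/
noncomputable def coboundaries (D : ∀ n, Submodule R (S n → A)) : ∀ n, Submodule R (S n → A)
  | 0 => ⊥
  | n + 1 => (D n).map (coboundary R n)

/-- Cocycles modulo coboundaries, for a complex `D` of cochains. -/
def Cohomology (D : ∀ n, Submodule R (S n → A)) (n : ℕ) : Type _ :=
  cocycles D n ⧸ (coboundaries D n).submoduleOf (cocycles D n)

noncomputable instance (D : ∀ n, Submodule R (S n → A)) (n : ℕ) : AddCommGroup (Cohomology D n) :=
  inferInstanceAs (AddCommGroup (cocycles D n ⧸ (coboundaries D n).submoduleOf (cocycles D n)))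

noncomputable instance (D : ∀ n, Submodule R (S n → A)) (n : ℕ) : Module R (Cohomology D n) :=
  inferInstanceAs (Module R (cocycles D n ⧸ (coboundaries D n).submoduleOf (cocycles D n)))

/-- The cohomology class of a cocycle. -/
noncomputable def Cohomology.mk (D : ∀ n, Submodule R (S n → A)) (n : ℕ) :
    cocycles D n →ₗ[R] Cohomology D n :=
  Submodule.mkQ _

theorem Cohomology.mk_surjective (D : ∀ n, Submodule R (S n → A)) (n : ℕ) :
    Function.Surjective (Cohomology.mk D n) :=
  Submodule.mkQ_surjective _

theorem Cohomology.mk_eq_zero {D : ∀ n, Submodule R (S n → A)} {n : ℕ} {f : cocycles D n} :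
    Cohomology.mk D n f = 0 ↔ (f : S n → A) ∈ coboundaries D n :=
  Submodule.Quotient.mk_eq_zero _

end Cohomology

/-! ### Products in cohomology

`T` is a family of simplices over `S`, and `D` is a complex of cochains on `T` that is stable
under cup products with cochains coming from `S`. -/

/-- A map of families of simplices. -/
structure FamilyMap (S : ℕ → Type u) (T : ℕ → Type u) [SimplexFamily S] [SimplexFamily T] where
  /-- the map on `n`-simplices -/
  app : ∀ n, S n → T n
  app_restr : ∀ {m n : ℕ} (φ : Fin (m + 1) → Fin (n + 1)) (x : S n),
    app m (restr φ x) = restr φ (app n x)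

/-- The identity map of a family of simplices. -/
def FamilyMap.id (S : ℕ → Type u) [SimplexFamily S] : FamilyMap S S :=
  ⟨fun _ x => x, fun _ _ => rfl⟩

section Product

variable {R : Type v} [CommRing R] {S T : ℕ → Type u} [SimplexFamily S] [SimplexFamily T]
  {A : Type w} [AddCommGroup A] [Module R A]

theorem FamilyMap.coboundary_comp (π : FamilyMap T S) {n : ℕ} (a : S n → A) :
    coboundary R n (a ∘ π.app n) = coboundary R n a ∘ π.app (n + 1) := by
  ext x
  simp [coboundary_apply, π.app_restr]

theorem FamilyMap.cup_comp (π : FamilyMap T S) {i j : ℕ} (a : S i → R) (b : S j → A) :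
    cup a b ∘ π.app (i + j) = cup (a ∘ π.app i) (b ∘ π.app j) := by
  ext x
  simp [cup, π.app_restr]

/-- `D` is stable under cup products with (all) cochains of `S`. -/
def CupStable (π : FamilyMap T S) (D : ∀ n, Submodule R (T n → A)) : Prop :=
  ∀ (i j : ℕ) (a : S i → R) (f : T j → A), f ∈ D j → cup (a ∘ π.app i) f ∈ D (i + j)

/-- All cochains on `S` with values in `R`. -/
def allCochains (R : Type v) [CommRing R] (S : ℕ → Type u) (n : ℕ) : Submodule R (S n → R) := ⊤

variable (R S) in
theorem cupStable_allCochains : CupStable (FamilyMap.id S) (allCochains R S) :=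
  fun _ _ _ _ _ => Submodule.mem_top

variable {π : FamilyMap T S} {D : ∀ n, Submodule R (T n → A)}

theorem mem_coboundaries_of_eq {m n : ℕ} (h : n = m + 1) {g : T m → A} (hg : g ∈ D m)
    {f : T n → A}
    (hf : ∀ x : T n, f x = coboundary R m g (restr (Fin.cast (by omega)) x)) :
    f ∈ coboundaries D n := by
  subst h
  refine ⟨g, hg, funext fun x => ?_⟩
  rw [hf]
  exact (congrArg _ (restr_id x)).symm

theorem cup_mem_cocycles (hD : CupStable π D) {i j : ℕ} {a : S i → R} {f : T j → A}
    (ha : a ∈ cocycles (allCochains R S) i) (hf : f ∈ cocycles D j) :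
    cup (a ∘ π.app i) f ∈ cocycles D (i + j) := by
  refine ⟨hD i j a f hf.1, LinearMap.mem_ker.2 (funext fun x => ?_)⟩
  have ha' : coboundary R i a = 0 := ha.2
  have hf' : coboundary R j f = 0 := hf.2
  simp [coboundary_cup, π.coboundary_comp, ha', hf']

theorem cup_mem_coboundaries_left (hD : CupStable π D) {i j : ℕ} {a : S i → R} {f : T j → A}
    (ha : a ∈ coboundaries (allCochains R S) i) (hf : f ∈ cocycles D j) :
    cup (a ∘ π.app i) f ∈ coboundaries D (i + j) := by
  have hf' : coboundary R j f = 0 := hf.2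
  cases i with
  | zero =>
    obtain rfl : a = 0 := ha
    convert Submodule.zero_mem _
    ext x
    simp [cup]
  | succ i =>
    obtain ⟨b, -, rfl⟩ := ha
    refine mem_coboundaries_of_eq (m := i + j) (by omega) (hD i j b f hf.1) fun x => ?_
    rw [coboundary_cup, hf', ← π.coboundary_comp]
    simp only [cup, restr_restr, Pi.zero_apply, smul_zero, add_zero]
    congr 3

theorem cup_mem_coboundaries_right (hD : CupStable π D) {i j : ℕ} {a : S i → R} {f : T j → A}
    (ha : a ∈ cocycles (allCochains R S) i) (hf : f ∈ coboundaries D j) :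
    cup (a ∘ π.app i) f ∈ coboundaries D (i + j) := by
  have ha' : coboundary R i a = 0 := ha.2
  cases j with
  | zero =>
    obtain rfl : f = 0 := hf
    convert Submodule.zero_mem _
    ext x
    simp [cup]
  | succ j =>
    obtain ⟨g, hg, rfl⟩ := hf
    have h := mem_coboundaries_of_eq (f := cup (a ∘ π.app i) (coboundary R j g)) (n := i + (j + 1))
      (m := i + j) (by omega) (Submodule.smul_mem _ ((-1 : R) ^ i) (hD i j a g hg)) fun x => ?_
    · exact h
    rw [map_smul, Pi.smul_apply, coboundary_cup, π.coboundary_comp, ha']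
    simp only [cup, Function.comp, Pi.zero_apply, zero_smul, zero_add, restr_restr]
    rw [← Int.cast_smul_eq_zsmul R, smul_smul]
    push_cast
    rw [← mul_pow, neg_one_mul, neg_neg, one_pow, one_smul]
    congr 3

/-- The cup product of cocycles, with values in cohomology. -/
noncomputable def cupCocycles (hD : CupStable π D) (i j : ℕ) :
    cocycles (allCochains R S) i →ₗ[R] cocycles D j →ₗ[R] Cohomology D (i + j) :=
  LinearMap.mk₂ R
    (fun a f => Cohomology.mk _ _
      ⟨cup ((a : S i → R) ∘ π.app i) (f : T j → A), cup_mem_cocycles hD a.2 f.2⟩)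
    (fun a b f => by
      rw [← map_add]
      congr 1; ext x; simp [cup, add_smul])
    (fun r a f => by
      rw [← map_smul]
      congr 1; ext x; simp [cup, mul_smul])
    (fun a f g => by
      rw [← map_add]
      congr 1; ext x; simp [cup])
    (fun r a f => by
      rw [← map_smul]
      congr 1; ext x; simp [cup, smul_comm r])

/-- The cup product `[a] ∪ [f] = [a ∪ f]` in cohomology. -/
noncomputable def cupProduct (hD : CupStable π D) (i j : ℕ) :
    Cohomology (allCochains R S) i →ₗ[R] Cohomology D j →ₗ[R] Cohomology D (i + j) :=
  Submodule.liftQ _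
    (LinearMap.flip (Submodule.liftQ _ (LinearMap.flip (cupCocycles hD i j)) (by
      intro f hf
      rw [LinearMap.mem_ker]
      ext a
      exact Cohomology.mk_eq_zero.2 (cup_mem_coboundaries_right hD a.2 hf)))) (by
    intro a ha
    rw [LinearMap.mem_ker]
    refine LinearMap.ext fun f => ?_
    obtain ⟨f, rfl⟩ := Cohomology.mk_surjective _ _ f
    exact Cohomology.mk_eq_zero.2 (cup_mem_coboundaries_left hD ha f.2))

theorem cupProduct_mk (hD : CupStable π D) {i j : ℕ} (a : cocycles (allCochains R S) i)
    (f : cocycles D j) :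
    cupProduct hD i j (Cohomology.mk _ _ a) (Cohomology.mk _ _ f) =
      Cohomology.mk _ _
        ⟨cup ((a : S i → R) ∘ π.app i) (f : T j → A), cup_mem_cocycles hD a.2 f.2⟩ := rfl

theorem mk_eq_mk {m n : ℕ} (h : m = n) (f : cocycles D m) (g : cocycles D n)
    (hfg : ∀ x : T n, (f : T m → A) (restr (Fin.cast (by omega)) x) = (g : T n → A) x) :
    (GradedMonoid.mk m (Cohomology.mk _ _ f) : GradedMonoid (Cohomology D)) =
      GradedMonoid.mk n (Cohomology.mk _ _ g) := by
  subst h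
  congr 2
  ext x
  rw [← hfg x]
  exact congrArg _ (restr_id x).symm

theorem cupProduct_assoc (hD : CupStable π D) {i j k : ℕ} (a : Cohomology (allCochains R S) i)
    (b : Cohomology (allCochains R S) j) (f : Cohomology D k) :
    (GradedMonoid.mk _ (cupProduct hD (i + j) k (cupProduct (cupStable_allCochains R S) i j a b) f) :
        GradedMonoid (Cohomology D)) =
      GradedMonoid.mk _ (cupProduct hD i (j + k) a (cupProduct hD j k b f)) := by
  obtain ⟨a, rfl⟩ := Cohomology.mk_surjective _ _ a
  obtain ⟨b, rfl⟩ := Cohomology.mk_surjective _ _ b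
  obtain ⟨f, rfl⟩ := Cohomology.mk_surjective _ _ f
  simp only [cupProduct_mk]
  refine (mk_eq_mk (add_assoc i j k).symm _ _ fun x => ?_).symm
  change cup _ (cup _ _) _ = cup (cup _ _ ∘ π.app _) _ x
  rw [π.cup_comp, cup_assoc]
  rfl

/-- The unit cocycle: the constant function `1` on `0`-simplices. -/
def oneCocycle (R : Type v) [CommRing R] (S : ℕ → Type u) [SimplexFamily S] :
    cocycles (allCochains R S) 0 :=
  ⟨fun _ => 1, Submodule.mem_top, LinearMap.mem_ker.2 (funext fun x => by
    simp [coboundary_apply, Fin.sum_univ_two])⟩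

theorem one_cupProduct (hD : CupStable π D) {j : ℕ} (f : Cohomology D j) :
    (GradedMonoid.mk _ (cupProduct hD 0 j (Cohomology.mk _ _ (oneCocycle R S)) f) :
        GradedMonoid (Cohomology D)) = GradedMonoid.mk j f := by
  obtain ⟨f, rfl⟩ := Cohomology.mk_surjective _ _ f
  rw [cupProduct_mk]
  refine mk_eq_mk (by omega) _ _ fun x => ?_
  simp only [cup, oneCocycle, Function.comp, one_smul, restr_restr]
  rw [show Fin.cast _ ∘ interval 0 j le_rfl = id by funext m; ext; simp [interval], restr_id]

theorem cupProduct_one {i : ℕ} (a : Cohomology (allCochains R S) i) :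
    (GradedMonoid.mk _ (cupProduct (cupStable_allCochains R S) i 0 a
        (Cohomology.mk _ _ (oneCocycle R S))) :
        GradedMonoid (Cohomology (allCochains R S))) = GradedMonoid.mk i a := by
  obtain ⟨a, rfl⟩ := Cohomology.mk_surjective _ _ a
  rw [cupProduct_mk]
  refine mk_eq_mk (by omega) _ _ fun x => ?_
  simp only [cup, oneCocycle, Function.comp, smul_eq_mul, mul_one, restr_restr, FamilyMap.id]
  rw [show Fin.cast _ ∘ interval (n := i + 0) 0 i (by omega) = id by
    funext m; ext; simp [interval], restr_id]

noncomputable instance : GradedMonoid.GMul (Cohomology (allCochains R S)) where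
  mul a b := cupProduct (cupStable_allCochains R S) _ _ a b

noncomputable instance : GradedMonoid.GOne (Cohomology (allCochains R S)) where
  one := Cohomology.mk _ _ (oneCocycle R S)

/-- The cup product makes cohomology a graded ring. -/
noncomputable instance : DirectSum.GRing (Cohomology (allCochains R S)) where
  mul_zero a := map_zero _
  zero_mul b := by
    change cupProduct (cupStable_allCochains R S) _ _ 0 b = 0
    rw [map_zero, LinearMap.zero_apply]
  mul_add a b c := map_add _ b c
  add_mul a b c := by
    change cupProduct (cupStable_allCochains R S) _ _ (a + b) c = _
    rw [map_add]; rfl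
  one_mul a := one_cupProduct (cupStable_allCochains R S) a.2
  mul_one a := cupProduct_one a.2
  mul_assoc a b c := cupProduct_assoc (cupStable_allCochains R S) a.2 b.2 c.2
  natCast n := n • Cohomology.mk _ _ (oneCocycle R S)
  natCast_zero := zero_nsmul _
  natCast_succ n := succ_nsmul _ n
  intCast n := n • Cohomology.mk _ _ (oneCocycle R S)
  intCast_ofNat n := natCast_zsmul _ n
  intCast_negSucc_ofNat n := negSucc_zsmul _ n

/-- The cup product makes the cohomology of `D` a graded module over the cohomology ring of `S`. -/
@[reducible]
noncomputable def gmoduleOfCupStable (hD : CupStable π D) :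
    DirectSum.Gmodule (Cohomology (allCochains R S)) (Cohomology D) where
  smul a f := cupProduct hD _ _ a f
  one_smul f := by
    obtain ⟨j, f⟩ := f
    exact one_cupProduct hD f
  mul_smul a b f := by
    obtain ⟨i, a⟩ := a
    obtain ⟨j, b⟩ := b
    obtain ⟨k, f⟩ := f
    exact cupProduct_assoc hD a b f
  smul_add a f g := map_add _ f g
  smul_zero a := map_zero _
  add_smul a b f := by
    change cupProduct hD _ _ (a + b) f = _
    rw [map_add]; rfl
  zero_smul f := by
    change cupProduct hD _ _ 0 f = 0
    rw [map_zero, LinearMap.zero_apply]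

end Product

/-! ### The singular cohomology of a space, and twisted coefficients -/

section Spaces

variable (Y : Type u) [TopologicalSpace Y]

/-- Singular simplices of `Y`. -/
def Singular (n : ℕ) : Type u := C(Simplex n, Y)

instance : SimplexFamily (Singular Y) where
  pull f σ := ContinuousMap.comp σ f
  pull_id _ := rfl
  pull_comp _ _ _ := rfl

variable (R : Type v) [CommRing R]

/-- The singular cohomology group `Hⁿ(Y; R)`. With the cup product these groups form a graded
ring. -/
abbrev SingularCohomology (n : ℕ) : Type _ := Cohomology (allCochains R (Singular Y)) n

variable {Y}

/-- A singular simplex of the universal cover of `(Y, y₀)`. The points of the universal cover over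
`y` are the homotopy classes of paths from `y₀` to `y`; so such a simplex is a singular simplex `σ`
of `Y` together with, for each point `t` of the standard simplex, a homotopy class of paths from
`y₀` to `σ t`, these classes being transported into each other along `σ`. -/
@[ext]
structure Lifted (y₀ : Y) (n : ℕ) : Type u where
  /-- the underlying singular simplex of `Y` -/
  base : C(Simplex n, Y)
  /-- the lift of `σ t` to the universal cover -/
  lift : ∀ t, Path.Homotopic.Quotient y₀ (base t)
  lift_trans : ∀ {s t : Simplex n} (e : Path s t),
    lift t = (lift s).trans (Path.Homotopic.Quotient.map (.mk e) base)

variable (y₀ : Y)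

noncomputable instance : SimplexFamily (Lifted y₀) where
  pull f x := ⟨x.base.comp f, fun t => x.lift (f t), fun e => x.lift_trans (e.map f.continuous)⟩
  pull_id _ := rfl
  pull_comp _ _ _ := rfl

/-- The action of `π₁(Y, y₀)` on the simplices of the universal cover by deck transformations.
In Mathlib the product `g * h` in the fundamental group is "first `h`, then `g`", so
precomposing paths with the loop `g⁻¹` is a left action. -/
noncomputable instance (n : ℕ) : MulAction (FundamentalGroup Y y₀) (Lifted y₀ n) where
  smul g x := ⟨x.base, fun t => (FundamentalGroup.toPath g⁻¹).trans (x.lift t), fun e => by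
    rw [x.lift_trans e, Path.Homotopic.Quotient.trans_assoc]⟩
  one_smul x := by
    refine Lifted.ext rfl (heq_of_eq (funext fun t => ?_))
    exact (congrArg (fun q => Path.Homotopic.Quotient.trans q (x.lift t))
      (inv_one (G := FundamentalGroup Y y₀))).trans (Path.Homotopic.Quotient.refl_trans _)
  mul_smul g h x := by
    refine Lifted.ext rfl (heq_of_eq (funext fun t => ?_))
    exact (congrArg (fun q => Path.Homotopic.Quotient.trans q (x.lift t))
      (mul_inv_rev g h)).trans (Path.Homotopic.Quotient.trans_assoc _ _ _)

variable {R} {M : Type w} [AddCommGroup M] [Module R M]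
  (ρ : Representation R (FundamentalGroup Y y₀) M)

/-- The `π₁(Y, y₀)`-equivariant cochains on the universal cover with values in `M`, that is,
`Hom_{R[π₁]}(C_n(Ỹ; R), M)`. -/
def twistedCochains (n : ℕ) : Submodule R (Lifted y₀ n → M) where
  carrier := {f | ∀ g x, f (g • x) = ρ g (f x)}
  zero_mem' := by simp
  add_mem' hf hg := by simp_all
  smul_mem' r f hf := by simp_all

/-- The cohomology `Hⁿ(Y; M)` with twisted coefficients. -/
abbrev TwistedCohomology (n : ℕ) : Type _ := Cohomology (twistedCochains y₀ ρ) n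

/-- The projection from simplices of the universal cover to simplices of `Y`. -/
def projection : FamilyMap (Lifted y₀) (Singular Y) := ⟨fun _ x => x.base, fun _ _ => rfl⟩

theorem restr_smul {m n : ℕ} (φ : Fin (m + 1) → Fin (n + 1)) (g : FundamentalGroup Y y₀)
    (x : Lifted y₀ n) : restr φ (g • x) = g • restr φ x := rfl

theorem coboundary_mem_twistedCochains {n : ℕ} {f : Lifted y₀ n → M}
    (hf : f ∈ twistedCochains y₀ ρ n) : coboundary R n f ∈ twistedCochains y₀ ρ (n + 1) := by
  intro g x
  have hf' : ∀ g x, f (g • x) = ρ g (f x) := hf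
  simp [coboundary_apply, restr_smul, hf']

theorem cupStable_twistedCochains : CupStable (projection y₀) (twistedCochains y₀ ρ) := by
  intro i j a f hf g x
  have hf' : ∀ g x, f (g • x) = ρ g (f x) := hf
  simp only [cup, restr_smul, hf', map_smul]
  rfl

/-- The graded `H^*(Y; R)`-module structure of `H^*(Y; M)` given by the cup product. -/
noncomputable instance :
    DirectSum.Gmodule (SingularCohomology Y R) (TwistedCohomology y₀ ρ) :=
  gmoduleOfCupStable (cupStable_twistedCochains y₀ ρ)

end Spaces

end TwistedCoh

namespace TwistedCoh

/-! ### Functoriality of cohomology in the coefficients -/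

section Functoriality

variable {R : Type v} [CommRing R] {S T : ℕ → Type u} [SimplexFamily S] [SimplexFamily T]
  {A B : Type w} [AddCommGroup A] [Module R A] [AddCommGroup B] [Module R B]

/-! The argument is induction on the order of `M`. A `p`-group acting on a nonzero finite
`𝔽_p`-vector space fixes some `m ≠ 0` (`exists_ne_zero_fixed_vector`), so there is a short exact
sequence of coefficients `0 → 𝔽_p m → M → M / 𝔽_p m → 0` whose left term is trivial.

The fundamental group acts freely on the simplices of the universal cover, so twisted cochains lift
along surjections of coefficients (`exists_postcomp_eq`). Hence a class that dies in `H^*(Y; M / 𝔽_p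
m)` comes from `H^*(Y; 𝔽_p)`: it is a cup product `a ∪ [m]`, where `[m]` is the degree-0 class of
the constant cochain `m` (`exists_cupProduct_eq_of_cohomologyMap_eq_zero`). Only this exactness in
the middle is needed, no connecting map.

The kernel of `H^*(Y; M) → H^*(Y; M / 𝔽_p m)` therefore lies in a cyclic module over the Noetherian
ring `H^*(Y; 𝔽_p)`, and the target is Noetherian by induction; so `H^*(Y; M)` is Noetherian
(`isNoetherian_of_quotient_by_fixed_vector`). -/

theorem coboundary_postcomp (q : A →ₗ[R] B) {n : ℕ} (f : T n → A) :
    coboundary R n (q ∘ f) = q ∘ coboundary R n f := by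
  ext x
  simp [coboundary_apply]

theorem cup_postcomp (q : A →ₗ[R] B) {i j : ℕ} (a : T i → R) (f : T j → A) :
    cup a (q ∘ f) = q ∘ cup a f := by
  ext x
  simp [cup]

/-- Composition with `q` maps the cochains in `D` to cochains in `E`. -/
def MapsCochains (q : A →ₗ[R] B) (D : ∀ n, Submodule R (T n → A))
    (E : ∀ n, Submodule R (T n → B)) : Prop :=
  ∀ (n : ℕ) (f : T n → A), f ∈ D n → q ∘ f ∈ E n

variable {q : A →ₗ[R] B} {D : ∀ n, Submodule R (T n → A)} {E : ∀ n, Submodule R (T n → B)}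

theorem MapsCochains.mem_cocycles (hq : MapsCochains q D E) {n : ℕ} {f : T n → A}
    (hf : f ∈ cocycles D n) : q ∘ f ∈ cocycles E n := by
  refine ⟨hq n f hf.1, LinearMap.mem_ker.2 ?_⟩
  have hf' : coboundary R n f = 0 := hf.2
  rw [coboundary_postcomp, hf']
  ext x
  simp

theorem MapsCochains.mem_coboundaries (hq : MapsCochains q D E) {n : ℕ} {f : T n → A}
    (hf : f ∈ coboundaries D n) : q ∘ f ∈ coboundaries E n := by
  cases n with
  | zero =>
    obtain rfl : f = 0 := hf
    convert Submodule.zero_mem _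
    ext x
    simp
  | succ n =>
    obtain ⟨g, hg, rfl⟩ := hf
    exact ⟨q ∘ g, hq n g hg, coboundary_postcomp q g⟩

/-- Composition of cocycles with `q`. -/
noncomputable def MapsCochains.cocyclesMap (hq : MapsCochains q D E) (n : ℕ) :
    cocycles D n →ₗ[R] cocycles E n where
  toFun f := ⟨q ∘ (f : T n → A), hq.mem_cocycles f.2⟩
  map_add' f g := by
    ext x
    simp
  map_smul' r f := by
    ext x
    simp

/-- The map induced by `q` in cohomology. -/
noncomputable def MapsCochains.cohomologyMap (hq : MapsCochains q D E) (n : ℕ) :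
    Cohomology D n →ₗ[R] Cohomology E n :=
  Submodule.liftQ _ (Cohomology.mk E n ∘ₗ hq.cocyclesMap n) fun _ hf =>
    LinearMap.mem_ker.2 (Cohomology.mk_eq_zero.2 (hq.mem_coboundaries hf))

theorem MapsCochains.cohomologyMap_mk (hq : MapsCochains q D E) {n : ℕ} (f : cocycles D n) :
    hq.cohomologyMap n (Cohomology.mk D n f) = Cohomology.mk E n (hq.cocyclesMap n f) := rfl

/-- On cochains the left factor of a cup product only contributes scalars, and `q` is linear. This
is what makes the change of coefficients linear over the cohomology ring. -/
theorem MapsCochains.cohomologyMap_cupProduct (hq : MapsCochains q D E) {π : FamilyMap T S}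
    (hD : CupStable π D) (hE : CupStable π E) {i j : ℕ} (a : Cohomology (allCochains R S) i)
    (f : Cohomology D j) :
    hq.cohomologyMap (i + j) (cupProduct hD i j a f) =
      cupProduct hE i j a (hq.cohomologyMap j f) := by
  obtain ⟨a, rfl⟩ := Cohomology.mk_surjective _ _ a
  obtain ⟨f, rfl⟩ := Cohomology.mk_surjective _ _ f
  rw [hq.cohomologyMap_mk, cupProduct_mk, cupProduct_mk, hq.cohomologyMap_mk]
  congr 1
  exact Subtype.ext (cup_postcomp q _ _).symm

end Functoriality

/-! ### The action of the fundamental group on the simplices of the universal cover -/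

section Covering

instance (n : ℕ) : ContractibleSpace (Simplex n) :=
  (convex_stdSimplex ℝ (Fin (n + 1))).contractibleSpace
    (isPathConnected_stdSimplex (Fin (n + 1))).nonempty

variable {Y : Type u} [TopologicalSpace Y] {y₀ : Y}

/-- Deck transformations act transitively on the lifts of a simplex. -/
theorem exists_smul_eq_of_base_eq {n : ℕ} {x x' : Lifted y₀ n} (h : x.base = x'.base) :
    ∃ g : FundamentalGroup Y y₀, g • x = x' := by
  obtain ⟨σ, l, hl⟩ := x
  obtain ⟨σ', l', hl'⟩ := x'
  obtain rfl : σ = σ' := h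
  obtain ⟨s⟩ : Nonempty (Simplex n) := inferInstance
  let γ : FundamentalGroup Y y₀ := FundamentalGroup.fromPath ((l' s).trans (l s).symm)
  -- An element `g` acts by prefixing paths with `g⁻¹`, so `γ⁻¹` prefixes the loop `γ`. That loop
  -- carries the lift at `s` correctly, and transport along `e` then settles every `t`.
  refine ⟨γ⁻¹, Lifted.ext rfl (heq_of_eq (funext fun t => ?_))⟩
  have e : Path s t := PathConnectedSpace.somePath s t
  change (FundamentalGroup.toPath γ⁻¹⁻¹).trans (l t) = l' t
  rw [inv_inv, hl e, hl' e]
  change ((l' s).trans (l s).symm).trans ((l s).trans _) = _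
  rw [Path.Homotopic.Quotient.trans_assoc, ← Path.Homotopic.Quotient.trans_assoc (l s).symm,
    Path.Homotopic.Quotient.symm_trans, Path.Homotopic.Quotient.refl_trans]

/-- Deck transformations act freely. -/
theorem eq_one_of_smul_eq {n : ℕ} {g : FundamentalGroup Y y₀} {x : Lifted y₀ n}
    (h : g • x = x) : g = 1 := by
  obtain ⟨s⟩ : Nonempty (Simplex n) := inferInstance
  have h1 : (FundamentalGroup.toPath g⁻¹).trans (x.lift s) = x.lift s := by
    have h2 := (Lifted.ext_iff.1 h).2
    exact congrFun (eq_of_heq h2) s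
  have h3 := congrArg (fun c => Path.Homotopic.Quotient.trans c (x.lift s).symm) h1
  simp only [Path.Homotopic.Quotient.trans_assoc, Path.Homotopic.Quotient.trans_symm,
    Path.Homotopic.Quotient.trans_refl] at h3
  exact inv_eq_one.1 h3

/-- Every singular simplex of a path-connected space lifts to the universal cover. -/
theorem exists_base_eq [PathConnectedSpace Y] {n : ℕ} (σ : C(Simplex n, Y)) :
    ∃ x : Lifted y₀ n, x.base = σ := by
  obtain ⟨s⟩ : Nonempty (Simplex n) := inferInstance
  let c : Path.Homotopic.Quotient y₀ (σ s) := .mk (PathConnectedSpace.somePath y₀ (σ s))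
  refine ⟨⟨σ, fun t => c.trans
    (Path.Homotopic.Quotient.map (.mk (PathConnectedSpace.somePath s t)) σ), fun {t t'} e => ?_⟩,
    rfl⟩
  -- The simplex is contractible, so any two paths in it with the same endpoints are homotopic; the
  -- chosen paths need not be compatible.
  rw [Path.Homotopic.Quotient.trans_assoc, Subsingleton.elim
    (Path.Homotopic.Quotient.mk (PathConnectedSpace.somePath s t'))
    (Path.Homotopic.Quotient.mk ((PathConnectedSpace.somePath s t).trans e))]
  simp only [← Path.Homotopic.Quotient.mk_map, ← Path.Homotopic.Quotient.mk_trans, Path.map_trans]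

end Covering

/-! ### Twisted cochains -/

section Twisted

variable {Y : Type u} [TopologicalSpace Y] {y₀ : Y} {R : Type v} [CommRing R]
  {M N : Type w} [AddCommGroup M] [Module R M] [AddCommGroup N] [Module R N]
  {ρ : Representation R (FundamentalGroup Y y₀) M} {τ : Representation R (FundamentalGroup Y y₀) N}
  {q : M →ₗ[R] N}

theorem mapsCochains_twistedCochains (hq : ∀ g m, q (ρ g m) = τ g (q m)) :
    MapsCochains q (twistedCochains y₀ ρ) (twistedCochains y₀ τ) := by
  intro n f hf g x
  have hf' : ∀ g x, f (g • x) = ρ g (f x) := hf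
  simp [hf', hq]

/-- Twisted cochains lift along surjective maps of coefficients. -/
theorem exists_postcomp_eq (hq : ∀ g m, q (ρ g m) = τ g (q m)) (hs : Function.Surjective q) {n : ℕ}
    {f : Lifted y₀ n → N} (hf : f ∈ twistedCochains y₀ τ n) :
    ∃ f' ∈ twistedCochains y₀ ρ n, q ∘ f' = f := by
  have hf' : ∀ g x, f (g • x) = τ g (f x) := hf
  -- `r x` is a chosen representative of the orbit of `x`. Below, `c x` is the group element taking
  -- it to `x`; by freeness it is unique, hence `c` is equivariant.
  let r : Lifted y₀ n → Lifted y₀ n := fun x =>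
    (Quotient.mk (MulAction.orbitRel (FundamentalGroup Y y₀) (Lifted y₀ n)) x).out
  have hr : ∀ x, ∃ g : FundamentalGroup Y y₀, g • r x = x := fun x =>
    MulAction.orbitRel_apply.1 ((MulAction.orbitRel (FundamentalGroup Y y₀) (Lifted y₀ n)).symm
      (Quotient.mk_out (s := MulAction.orbitRel (FundamentalGroup Y y₀) (Lifted y₀ n)) x))
  have hr_smul : ∀ (g : FundamentalGroup Y y₀) x, r (g • x) = r x := fun g x =>
    congrArg Quotient.out (Quotient.sound (MulAction.orbitRel_apply.2 ⟨g, rfl⟩))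
  choose c hc using hr
  have hc_smul : ∀ g x, c (g • x) = g * c x := by
    intro g x
    have h1 : c (g • x) • r x = (g * c x) • r x := by
      rw [mul_smul, hc, ← hr_smul g, hc]
    have h2 : ((g * c x)⁻¹ * c (g • x)) • r x = r x := by
      rw [mul_smul, h1, inv_smul_smul]
    exact (inv_mul_eq_one.1 (eq_one_of_smul_eq h2)).symm
  choose l hl using hs
  -- Values are lifted arbitrarily on the orbit representatives and extended equivariantly.
  refine ⟨fun x => ρ (c x) (l (f (r x))), fun g x => ?_, funext fun x => ?_⟩
  · simp only [hc_smul, hr_smul, map_mul, Module.End.mul_apply]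
  · change q _ = _
    rw [hq, hl, ← hf', hc]

/-! ### Cochains with values in the line of a fixed vector -/

/-- The cocycle with constant value a fixed vector. -/
def constCocycle (y₀ : Y) (ρ : Representation R (FundamentalGroup Y y₀) M) {m : M}
    (hm : ∀ g, ρ g m = m) : cocycles (twistedCochains y₀ ρ) 0 :=
  ⟨fun _ => m, fun g _ => (hm g).symm, LinearMap.mem_ker.2 (funext fun x => by
    simp [coboundary_apply, Fin.sum_univ_two])⟩

/-- Identifies the map `Hⁿ(Y; R) → Hⁿ(Y; M)` induced by `r ↦ r • m` with the cup product by a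
degree-0 class, so that its image lies in a cyclic module. -/
theorem cupProduct_constCocycle {m : M} (hm : ∀ g, ρ g m = m) {n : ℕ}
    (a : cocycles (allCochains R (Singular Y)) n) (f : cocycles (twistedCochains y₀ ρ) n)
    (h : ∀ x : Lifted y₀ n, (f : Lifted y₀ n → M) x = (a : Singular Y n → R) x.base • m) :
    cupProduct (cupStable_twistedCochains y₀ ρ) n 0 (Cohomology.mk _ _ a)
      (Cohomology.mk _ _ (constCocycle y₀ ρ hm)) = Cohomology.mk _ n f := by
  rw [cupProduct_mk]
  congr 1
  refine Subtype.ext (funext fun x => ?_)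
  rw [h]
  change (a : Singular Y n → R) _ • m = _
  refine congrArg (fun σ => (a : Singular Y n → R) σ • m) ?_
  change (restr (interval (n := n + 0) 0 n (by omega)) x).base = x.base
  rw [show interval (n := n + 0) 0 n (by omega) = id by funext m; ext; simp [interval], restr_id]

/-- A twisted cochain whose values are multiples of a fixed vector comes from a cochain on `Y`. -/
theorem exists_cochain_of_mem_span {k : Type v} [Field k] {V : Type w} [AddCommGroup V]
    [Module k V] [PathConnectedSpace Y] {ρ : Representation k (FundamentalGroup Y y₀) V} {m : V}
    (hm : ∀ g, ρ g m = m) {n : ℕ} {f : Lifted y₀ n → V} (hf : f ∈ twistedCochains y₀ ρ n)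
    (h : ∀ x, f x ∈ Submodule.span k {m}) :
    ∃ a : Singular Y n → k, ∀ x : Lifted y₀ n, f x = a x.base • m := by
  have hf' : ∀ g x, f (g • x) = ρ g (f x) := hf
  choose l hl using fun σ : C(Simplex n, Y) => exists_base_eq (y₀ := y₀) σ
  choose c hc using fun x => Submodule.mem_span_singleton.1 (h x)
  refine ⟨fun σ => c (l σ), fun x => ?_⟩
  -- `x` and the chosen lift of its base differ by a deck transformation, which fixes `m`; so both
  -- have the same coefficient.
  obtain ⟨g, hg⟩ := exists_smul_eq_of_base_eq (hl x.base)
  rw [hc]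
  conv_lhs => rw [← hg]
  rw [hf', ← hc, map_smul, hm]

/-- The coboundary of `f` at `x` is that of `a` at `x.base`, times `m`. Since `m ≠ 0` and every
simplex of `Y` lifts, nothing is lost. -/
theorem coboundary_eq_zero_of_smul {k : Type v} [Field k] {V : Type w} [AddCommGroup V]
    [Module k V] [PathConnectedSpace Y] {m : V} (hm : m ≠ 0) {n : ℕ} {f : Lifted y₀ n → V}
    (hf : coboundary k n f = 0) {a : Singular Y n → k}
    (h : ∀ x : Lifted y₀ n, f x = a x.base • m) : coboundary k n a = 0 := by
  ext σ
  obtain ⟨x, rfl⟩ := exists_base_eq (y₀ := y₀) σ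
  have h1 := congrFun hf x
  simp only [coboundary_apply, h, Pi.zero_apply] at h1 ⊢
  simp only [← smul_assoc, ← Finset.sum_smul] at h1
  exact (smul_eq_zero.1 h1).resolve_right hm

/-- Exactness of `Hⁿ(Y; k) → Hⁿ(Y; V) → Hⁿ(Y; V / k m)` in the middle, for a fixed vector
`m ≠ 0`. -/
theorem exists_cupProduct_eq_of_cohomologyMap_eq_zero {k : Type v} [Field k] {V W : Type w}
    [AddCommGroup V] [Module k V] [AddCommGroup W] [Module k W] [PathConnectedSpace Y]
    {ρ : Representation k (FundamentalGroup Y y₀) V}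
    {τ : Representation k (FundamentalGroup Y y₀) W} {q : V →ₗ[k] W}
    (hq : ∀ g m, q (ρ g m) = τ g (q m)) (hs : Function.Surjective q) {m : V}
    (hm : ∀ g, ρ g m = m) (hm0 : m ≠ 0) (hker : LinearMap.ker q = Submodule.span k {m}) {n : ℕ}
    {z : TwistedCohomology y₀ ρ n}
    (hz : (mapsCochains_twistedCochains hq).cohomologyMap n z = 0) :
    ∃ a, cupProduct (cupStable_twistedCochains y₀ ρ) n 0 a
      (Cohomology.mk _ _ (constCocycle y₀ ρ hm)) = z := by
  obtain ⟨f, rfl⟩ := Cohomology.mk_surjective _ _ z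
  rw [MapsCochains.cohomologyMap_mk, Cohomology.mk_eq_zero] at hz
  have hz' : q ∘ (f : Lifted y₀ n → V) ∈ coboundaries (twistedCochains y₀ τ) n := hz
  -- Lifting a bounding cochain of `q ∘ f` to `V` and taking its coboundary gives `b`. Then `f - b`
  -- is cohomologous to `f` and takes values in `ker q`, the line through `m`.
  obtain ⟨b, hb, hb'⟩ : ∃ b ∈ coboundaries (twistedCochains y₀ ρ) n,
      q ∘ b = q ∘ (f : Lifted y₀ n → V) := by
    cases n with
    | zero =>
      refine ⟨0, Submodule.zero_mem _, ?_⟩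
      rw [show q ∘ (f : Lifted y₀ 0 → V) = 0 from hz']
      ext x
      simp
    | succ n =>
      obtain ⟨g, hg, hg'⟩ := hz'
      obtain ⟨g', hg1, rfl⟩ := exists_postcomp_eq hq hs hg
      exact ⟨coboundary k n g', ⟨g', hg1, rfl⟩, (coboundary_postcomp q g').symm.trans hg'⟩
  have hbc : b ∈ cocycles (twistedCochains y₀ ρ) n := by
    cases n with
    | zero =>
      obtain rfl : b = 0 := hb
      exact Submodule.zero_mem _
    | succ n =>
      obtain ⟨g, hg, rfl⟩ := hb
      exact ⟨coboundary_mem_twistedCochains y₀ ρ hg,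
        LinearMap.mem_ker.2 (coboundary_coboundary n g)⟩
  let f' : cocycles (twistedCochains y₀ ρ) n := f - ⟨b, hbc⟩
  have hf' : Cohomology.mk (twistedCochains y₀ ρ) n f = Cohomology.mk _ n f' := by
    have h0 : Cohomology.mk (twistedCochains y₀ ρ) n ⟨b, hbc⟩ = 0 := Cohomology.mk_eq_zero.2 hb
    rw [map_sub, h0, sub_zero]
  obtain ⟨a, ha⟩ := exists_cochain_of_mem_span hm f'.2.1 fun x => by
    rw [← hker, LinearMap.mem_ker]
    change q ((f : Lifted y₀ n → V) x - b x) = 0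
    rw [map_sub, sub_eq_zero]
    exact (congrFun hb' x).symm
  have hac : a ∈ cocycles (allCochains k (Singular Y)) n :=
    ⟨Submodule.mem_top, coboundary_eq_zero_of_smul hm0 f'.2.2 ha⟩
  exact ⟨Cohomology.mk _ _ ⟨a, hac⟩, (cupProduct_constCocycle hm ⟨a, hac⟩ f' ha).trans hf'.symm⟩

/-! ### Change of coefficients over the cohomology ring -/

/-- The `H^*(Y; R)`-linear map on cohomology induced by an equivariant map of coefficients. -/
noncomputable def twistedCohomologyMap (hq : ∀ g m, q (ρ g m) = τ g (q m)) :
    (⨁ n, TwistedCohomology y₀ ρ n) →ₗ[⨁ n, SingularCohomology Y R n]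
      (⨁ n, TwistedCohomology y₀ τ n) where
  __ := DirectSum.map fun n =>
    ((mapsCochains_twistedCochains hq).cohomologyMap n).toAddMonoidHom
  map_smul' a z := by
    change DirectSum.map _ (a • z) = a • DirectSum.map _ z
    induction a using DirectSum.induction_on with
    | zero => simp only [zero_smul, map_zero]
    | add a b ha hb => simp only [add_smul, map_add, ha, hb]
    | of i a =>
      induction z using DirectSum.induction_on with
      | zero => simp only [smul_zero, map_zero]
      | add y z hy hz => simp only [smul_add, map_add, hy, hz]
      | of j z =>
        rw [DirectSum.Gmodule.of_smul_of, DirectSum.map_of, DirectSum.map_of,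
          DirectSum.Gmodule.of_smul_of]
        exact congrArg _ ((mapsCochains_twistedCochains hq).cohomologyMap_cupProduct _
          (cupStable_twistedCochains y₀ τ) a z)

theorem twistedCohomologyMap_apply (hq : ∀ g m, q (ρ g m) = τ g (q m))
    (z : ⨁ n, TwistedCohomology y₀ ρ n) (n : ℕ) :
    twistedCohomologyMap hq z n = (mapsCochains_twistedCochains hq).cohomologyMap n (z n) := rfl

/-- The map is graded, so each homogeneous component of a kernel element is again killed, and middle
exactness writes it as a multiple of the one generator. -/
theorem ker_twistedCohomologyMap_le {k : Type v} [Field k] {V W : Type w}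
    [AddCommGroup V] [Module k V] [AddCommGroup W] [Module k W] [PathConnectedSpace Y]
    {ρ : Representation k (FundamentalGroup Y y₀) V}
    {τ : Representation k (FundamentalGroup Y y₀) W} {q : V →ₗ[k] W}
    (hq : ∀ g m, q (ρ g m) = τ g (q m)) (hs : Function.Surjective q) {m : V}
    (hm : ∀ g, ρ g m = m) (hm0 : m ≠ 0) (hker : LinearMap.ker q = Submodule.span k {m}) :
    LinearMap.ker (twistedCohomologyMap hq) ≤
      Submodule.span (⨁ n, SingularCohomology Y k n)
        {DirectSum.of (TwistedCohomology y₀ ρ) 0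
          (Cohomology.mk _ _ (constCocycle y₀ ρ hm))} := by
  classical
  intro z hz
  rw [← DirectSum.sum_support_of z]
  refine Submodule.sum_mem _ fun n _ => ?_
  have hn : (mapsCochains_twistedCochains hq).cohomologyMap n (z n) = 0 := by
    rw [← twistedCohomologyMap_apply hq, LinearMap.mem_ker.1 hz, DirectSum.zero_apply]
  obtain ⟨a, ha⟩ := exists_cupProduct_eq_of_cohomologyMap_eq_zero hq hs hm hm0 hker hn
  refine Submodule.mem_span_singleton.2 ⟨DirectSum.of _ n a, ?_⟩
  rw [DirectSum.Gmodule.of_smul_of]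
  exact congrArg (DirectSum.of (TwistedCohomology y₀ ρ) n) ha

theorem isNoetherian_of_quotient_by_fixed_vector {k : Type v} [Field k] {V W : Type w}
    [AddCommGroup V] [Module k V] [AddCommGroup W] [Module k W] [PathConnectedSpace Y]
    {ρ : Representation k (FundamentalGroup Y y₀) V}
    {τ : Representation k (FundamentalGroup Y y₀) W} {q : V →ₗ[k] W}
    (hq : ∀ g m, q (ρ g m) = τ g (q m)) (hs : Function.Surjective q) {m : V}
    (hm : ∀ g, ρ g m = m) (hm0 : m ≠ 0) (hker : LinearMap.ker q = Submodule.span k {m})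
    [IsNoetherianRing (⨁ n, SingularCohomology Y k n)]
    [IsNoetherian (⨁ n, SingularCohomology Y k n) (⨁ n, TwistedCohomology y₀ τ n)] :
    IsNoetherian (⨁ n, SingularCohomology Y k n) (⨁ n, TwistedCohomology y₀ ρ n) := by
  have : IsNoetherian (⨁ n, SingularCohomology Y k n) (LinearMap.ker (twistedCohomologyMap hq)) := by
    have := isNoetherian_span_of_finite (⨁ n, SingularCohomology Y k n)
      (Set.finite_singleton (DirectSum.of (TwistedCohomology y₀ ρ) 0
          (Cohomology.mk _ _ (constCocycle y₀ ρ hm))))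
    exact isNoetherian_of_le (ker_twistedCohomologyMap_le hq hs hm hm0 hker)
  exact isNoetherian_of_range_eq_ker (LinearMap.ker (twistedCohomologyMap hq)).subtype
    (twistedCohomologyMap hq) (Submodule.range_subtype _)

end Twisted

/-- A `p`-group acting linearly on a nonzero finite `𝔽_p`-vector space fixes a nonzero vector. -/
theorem exists_ne_zero_fixed_vector {p : ℕ} [Fact p.Prime] {G : Type*} [Group G] [Finite G]
    (hG : IsPGroup p G) {V : Type*} [AddCommGroup V] [Module (ZMod p) V] [Finite V] [Nontrivial V]
    (ρ : Representation (ZMod p) G V) : ∃ m ≠ 0, ∀ g, ρ g m = m := by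
  let _ : MulAction G V :=
    { smul := fun g m => ρ g m
      one_smul := fun m => by change ρ 1 m = m; simp
      mul_smul := fun g h m => by change ρ (g * h) m = ρ g (ρ h m); simp }
  -- A nonzero vector has additive order `p`. The number of fixed points is congruent to the order
  -- of `V` modulo `p`, so `0` cannot be the only one.
  have hcard : p ∣ Nat.card V := by
    obtain ⟨m, hm⟩ := exists_ne (0 : V)
    have : addOrderOf m = p := addOrderOf_eq_prime (by
      rw [← Nat.cast_smul_eq_nsmul (ZMod p), CharP.cast_eq_zero, zero_smul]) hm
    exact this ▸ addOrderOf_dvd_natCard m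
  obtain ⟨m, hm, h0⟩ := hG.exists_fixed_point_of_prime_dvd_card_of_fixed_point V hcard
    (a := 0) fun g => map_zero (ρ g)
  exact ⟨m, h0.symm, hm⟩

end TwistedCoh

/-! ### Induction on the order of the coefficient module -/

open TwistedCoh in
theorem isNoetherian_twistedCohomology_of_card {Y : Type u} [TopologicalSpace Y]
    [PathConnectedSpace Y] (y₀ : Y) (p : ℕ) [Fact p.Prime] [Finite (FundamentalGroup Y y₀)]
    (hπ : IsPGroup p (FundamentalGroup Y y₀))
    (hY : IsNoetherianRing (⨁ n, SingularCohomology Y (ZMod p) n)) (d : ℕ) :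
    ∀ {M : Type w} [AddCommGroup M] [Module (ZMod p) M] [Finite M]
      (ρ : Representation (ZMod p) (FundamentalGroup Y y₀) M), Nat.card M = d →
      IsNoetherian (⨁ n, SingularCohomology Y (ZMod p) n) (⨁ n, TwistedCohomology y₀ ρ n) := by
  induction d using Nat.strong_induction_on with
  | _ d ih =>
  intro M _ _ _ ρ hd
  rcases subsingleton_or_nontrivial M with hM | hM
  · have : ∀ n, Subsingleton (TwistedCohomology y₀ ρ n) := fun n =>
      (Cohomology.mk_surjective _ n).subsingleton
    infer_instance
  obtain ⟨m, hm0, hm⟩ := exists_ne_zero_fixed_vector hπ ρ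
  let L := Submodule.span (ZMod p) {m}
  have hL : ∀ g, L ≤ L.comap (ρ g) := fun g =>
    (Submodule.span_singleton_le_iff_mem _ _).2 (by
      rw [Submodule.mem_comap, hm]
      exact Submodule.mem_span_singleton_self m)
  let τ := ρ.quotient L hL
  have hlt : Nat.card (M ⧸ L) < d := by
    rw [← hd]
    -- Equal orders would make the quotient map injective, but it kills `m ≠ 0`.
    refine lt_of_le_of_ne (Nat.card_le_card_of_surjective _ L.mkQ_surjective) fun h => hm0 ?_
    have hb := (Nat.bijective_iff_surjective_and_card L.mkQ).2 ⟨L.mkQ_surjective, h.symm⟩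
    refine hb.1 ?_
    rw [map_zero]
    exact (Submodule.Quotient.mk_eq_zero L).2 (Submodule.mem_span_singleton_self m)
  have : Finite (M ⧸ L) := Finite.of_surjective _ L.mkQ_surjective
  have := ih _ hlt τ rfl
  exact isNoetherian_of_quotient_by_fixed_vector (τ := τ) (q := L.mkQ) (fun g x => rfl)
    L.mkQ_surjective hm hm0 L.ker_mkQ

theorem theorem3p2 {Y : Type u} [TopologicalSpace Y] [PathConnectedSpace Y] (y₀ : Y)
    (p : ℕ) [Fact p.Prime] [Finite (FundamentalGroup Y y₀)]
    (hπ : IsPGroup p (FundamentalGroup Y y₀))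
    {M : Type w} [AddCommGroup M] [Module (ZMod p) M] [Finite M]
    (ρ : Representation (ZMod p) (FundamentalGroup Y y₀) M)
    (hY : IsNoetherianRing (⨁ n, TwistedCoh.SingularCohomology Y (ZMod p) n)) :
    IsNoetherian (⨁ n, TwistedCoh.SingularCohomology Y (ZMod p) n)
      (⨁ n, TwistedCoh.TwistedCohomology y₀ ρ n) :=
  isNoetherian_twistedCohomology_of_card y₀ p hπ hY _ ρ rfl
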